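/- Let $n \ge 0$ be an integer with $n \equiv 0$ or $1 \pmod 4$, and let $h$ be any integer with $\lfloor \frac{n+1}{2} \rfloor \le h \le \lfloor \frac{3n}{5} \rfloor$. Then there exists a self-complementary graph $G$ on $n$ vertices (a finite simple undirected graph isomorphic to its complement) whose Hadwiger number, that is, the order of the largest complete graph that is a minor of $G$, is exactly $h$. -/

import Mathlib

/-- A graph is self-complementary if it is isomorphic to its complement. -/
def SimpleGraph.IsSelfComplementary {V : Type*} (G : SimpleGraph V) : Prop :=
  Nonempty (G ≃g Gᶜ)

/-- `H` is a minor of `G`: there are pairwise disjoint vertex sets of `G` (the branch sets), one for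
each vertex of `H`, each inducing a nonempty connected subgraph of `G`, such that `G` has an edge
between the branch sets of any two adjacent vertices of `H`. For finite graphs this says that `H` is
obtained, up to isomorphism, from `G` by contracting the edges inside the branch sets and deleting
vertices and edges. -/
def SimpleGraph.IsMinorOf {W V : Type*} (H : SimpleGraph W) (G : SimpleGraph V) : Prop :=
  ∃ B : W → Set V,
    (∀ w, (G.induce (B w)).Connected) ∧
    (∀ u w, u ≠ w → Disjoint (B u) (B w)) ∧
    (∀ u w, H.Adj u w → ∃ x ∈ B u, ∃ y ∈ B w, G.Adj x y)

/-- The Hadwiger number of a finite graph: the largest `t` such that the complete graph on `t`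
vertices is a minor of `G`. -/
noncomputable def SimpleGraph.hadwigerNumber {V : Type*} [Finite V] (G : SimpleGraph V) : ℕ :=
  sSup {t : ℕ | (completeGraph (Fin t)).IsMinorOf G}

/-- The maximum in the definition of the Hadwiger number is attained. -/
theorem SimpleGraph.isGreatest_hadwigerNumber {V : Type*} [Finite V] (G : SimpleGraph V) :
    IsGreatest {t : ℕ | (completeGraph (Fin t)).IsMinorOf G} G.hadwigerNumber := by
  have hne : {t : ℕ | (completeGraph (Fin t)).IsMinorOf G}.Nonempty :=
    ⟨0, fun _ => ∅, fun w => w.elim0, fun u => u.elim0, fun u => u.elim0⟩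
  have hbd : BddAbove {t : ℕ | (completeGraph (Fin t)).IsMinorOf G} := by
    refine ⟨Nat.card V, ?_⟩
    rintro t ⟨B, hB, hd, -⟩
    have hx : ∀ w, ∃ x, x ∈ B w := fun w => by
      obtain ⟨x⟩ := (hB w).nonempty
      exact ⟨x.1, x.2⟩
    choose f hf using hx
    have hinj : Function.Injective f := by
      intro u w huw
      by_contra hne
      exact Set.disjoint_left.1 (hd u w hne) (hf u) (huw ▸ hf w)
    simpa using Nat.card_le_card_of_injective f hinj
  exact ⟨Nat.sSup_mem hne hbd, fun t ht => le_csSup hbd ht⟩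

/-! Induction on `n` in steps of four. Adding a path on four vertices with its inner vertices joined
to everything (`bull`) preserves self-complementarity and raises the Hadwiger number by exactly 2,
so `(n - 4, h - 2)` yields `(n, h)`. Since `3 * 4 / 5 > 2`, this step can leave the admissible
range, but only for `h = ⌊3n/5⌋` with `n ≡ 0` or `2 (mod 5)`.

Those extremal cases are built directly. For `n = 5t`, blow up the pentagon, which is
self-complementary under index doubling; for `n = 5t + 12`, attach a gadget on twelve vertices to
the blow-up. The lower bound uses branch sets that are vertices or edges. The upper bound is
`le_of_completeGraph_isMinorOf_of_degree_lt`: a singleton branch set is limited by its degree, and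
branch sets with at least two vertices are limited by the number of vertices. -/

namespace SimpleGraph

variable {V W V' W' : Type*}

/-! ### Complete minors -/

theorem connected_induce_image_iff {G : SimpleGraph V} {G' : SimpleGraph V'} (f : G ↪g G')
    (s : Set V) : (G'.induce (f '' s)).Connected ↔ (G.induce s).Connected := by
  have e : G.induce s ≃g G'.induce (f '' s) :=
    { toEquiv := Equiv.Set.image f s f.injective
      map_rel_iff' := by
        rintro ⟨a, ha⟩ ⟨b, hb⟩
        simp }
  exact e.connected_iff.symm

/-- A minor of an induced subgraph of `G` is a minor of `G`. -/
theorem IsMinorOf.of_embedding {H : SimpleGraph W} {G : SimpleGraph V} {G' : SimpleGraph V'}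
    (f : G ↪g G') (h : H.IsMinorOf G) : H.IsMinorOf G' := by
  obtain ⟨B, hc, hd, ha⟩ := h
  refine ⟨fun w => f '' B w, fun w => (connected_induce_image_iff f _).2 (hc w), fun u w huw => ?_,
    fun u w huw => ?_⟩
  · exact (Set.disjoint_image_iff f.injective).2 (hd u w huw)
  · obtain ⟨x, hx, y, hy, hxy⟩ := ha u w huw
    exact ⟨f x, ⟨x, hx, rfl⟩, f y, ⟨y, hy, rfl⟩, f.map_adj_iff.2 hxy⟩

/-- If all branch sets of a minor of `G'` lie in an induced subgraph, the latter has this minor. -/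
theorem isMinorOf_of_branchSets_subset_range {H : SimpleGraph W} {G : SimpleGraph V}
    {G' : SimpleGraph V'} (f : G ↪g G') (B : W → Set V')
    (hc : ∀ w, (G'.induce (B w)).Connected) (hd : ∀ u w, u ≠ w → Disjoint (B u) (B w))
    (ha : ∀ u w, H.Adj u w → ∃ x ∈ B u, ∃ y ∈ B w, G'.Adj x y)
    (hr : ∀ w, B w ⊆ Set.range f) : H.IsMinorOf G := by
  refine ⟨fun w => f ⁻¹' B w, fun w => ?_, fun u w huw => (hd u w huw).preimage f,
    fun u w huw => ?_⟩
  · rw [← connected_induce_image_iff f, Set.image_preimage_eq_of_subset (hr w)]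
    exact hc w
  · obtain ⟨x, hx, y, hy, hxy⟩ := ha u w huw
    obtain ⟨x, rfl⟩ := hr u hx
    obtain ⟨y, rfl⟩ := hr w hy
    exact ⟨x, hx, y, hy, f.map_adj_iff.1 hxy⟩

theorem isMinorOf_completeGraph_of_injective {G : SimpleGraph V} (f : W' → W)
    (hf : Function.Injective f) (h : (completeGraph W).IsMinorOf G) :
    (completeGraph W').IsMinorOf G := by
  obtain ⟨B, hc, hd, ha⟩ := h
  exact ⟨fun w => B (f w), fun w => hc _, fun u w huw => hd _ _ (hf.ne huw),
    fun u w huw => ha _ _ (hf.ne huw)⟩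

theorem hadwigerNumber_eq_iff [Finite V] {G : SimpleGraph V} {h : ℕ} :
    G.hadwigerNumber = h ↔ (completeGraph (Fin h)).IsMinorOf G ∧
      ∀ t, (completeGraph (Fin t)).IsMinorOf G → t ≤ h := by
  constructor
  · rintro rfl
    exact ⟨G.isGreatest_hadwigerNumber.1, fun t ht => G.isGreatest_hadwigerNumber.2 ht⟩
  · rintro ⟨h₁, h₂⟩
    exact G.isGreatest_hadwigerNumber.unique ⟨h₁, h₂⟩

theorem Iso.hadwigerNumber_eq [Finite V] [Finite V'] {G : SimpleGraph V} {G' : SimpleGraph V'}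
    (e : G ≃g G') : G.hadwigerNumber = G'.hadwigerNumber := by
  obtain ⟨h₁, h₂⟩ := hadwigerNumber_eq_iff.1 (rfl : G'.hadwigerNumber = _)
  exact hadwigerNumber_eq_iff.2
    ⟨h₁.of_embedding e.symm.toEmbedding, fun t ht => h₂ t (ht.of_embedding e.toEmbedding)⟩

/-- Branch sets given as vertices or edges `{x w, y w}`. -/
theorem isMinorOf_completeGraph_of_pairs {G : SimpleGraph V} (x y : W → V)
    (hxy : ∀ w, x w = y w ∨ G.Adj (x w) (y w))
    (hd : ∀ u w, u ≠ w → x u ≠ x w ∧ x u ≠ y w ∧ y u ≠ y w)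
    (ha : ∀ u w, u ≠ w →
      G.Adj (x u) (x w) ∨ G.Adj (x u) (y w) ∨ G.Adj (y u) (x w) ∨ G.Adj (y u) (y w)) :
    (completeGraph W).IsMinorOf G := by
  refine ⟨fun w => {x w, y w}, fun w => ?_, fun u w huw => ?_, fun u w huw => ?_⟩
  · change (G.induce {x w, y w}).Connected
    rcases hxy w with h | h
    · rw [← h, Set.pair_eq_singleton, induce_singleton_eq_top]
      exact connected_top
    · exact induce_pair_connected_of_adj h
  · obtain ⟨h₁, h₂, h₃⟩ := hd u w huw
    have h₄ := (hd w u huw.symm).2.1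
    simp [h₁.symm, h₂.symm, h₃.symm, h₄]
  · rcases ha u w huw with h | h | h | h
    · exact ⟨x u, by simp, x w, by simp, h⟩
    · exact ⟨x u, by simp, y w, by simp, h⟩
    · exact ⟨y u, by simp, x w, by simp, h⟩
    · exact ⟨y u, by simp, y w, by simp, h⟩

/-- A singleton branch set `{v}` of a complete minor bounds its order by `deg v + 1`. -/
theorem card_le_degree_add_one_of_singleton [Fintype V] {G : SimpleGraph V} [DecidableRel G.Adj]
    {t : ℕ} {B : Fin t → Set V} (hd : ∀ u w, u ≠ w → Disjoint (B u) (B w))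
    (ha : ∀ u w, u ≠ w → ∃ x ∈ B u, ∃ y ∈ B w, G.Adj x y) {w : Fin t} {v : V} (hw : B w = {v}) :
    t ≤ G.degree v + 1 := by
  have hx : ∀ u, ∃ x, u ≠ w → x ∈ B u ∧ G.Adj v x := fun u => by
    by_cases huw : u = w
    · exact ⟨v, fun h => absurd huw h⟩
    · obtain ⟨x, hx, y, hy, hxy⟩ := ha u w huw
      rw [hw, Set.mem_singleton_iff] at hy
      exact ⟨x, fun _ => ⟨hx, hy ▸ hxy.symm⟩⟩
  choose f hf using hx
  have : (Finset.univ.erase w).card ≤ (G.neighborFinset v).card := by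
    refine Finset.card_le_card_of_injOn f (fun u hu => ?_) (fun u hu u' hu' h => ?_)
    · simpa using (hf u (by simpa using hu)).2
    · by_contra hne
      exact Set.disjoint_left.1 (hd u u' hne) (hf u (by simpa using hu)).1
        (h ▸ (hf u' (by simpa using hu')).1)
  rw [Finset.card_erase_of_mem (Finset.mem_univ w), Finset.card_univ, Fintype.card_fin,
    card_neighborFinset_eq_degree] at this
  omega

/-- If all degrees are less than `h` and there are at most `2 * h + 1` vertices, then complete
minors have order at most `h`. -/
theorem le_of_completeGraph_isMinorOf_of_degree_lt [Fintype V] {G : SimpleGraph V}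
    [DecidableRel G.Adj] {h t : ℕ} (hdeg : ∀ v, G.degree v < h) (hcard : Fintype.card V ≤ 2 * h + 1)
    (ht : (completeGraph (Fin t)).IsMinorOf G) : t ≤ h := by
  obtain ⟨B, hc, hd, ha⟩ := ht
  by_cases hs : ∃ w v, B w = {v}
  · obtain ⟨w, v, hw⟩ := hs
    have := card_le_degree_add_one_of_singleton hd (fun u w huw => ha u w huw) hw
    have := hdeg v
    omega
  -- Without singletons, each branch set contains two distinct vertices, so `2 * t ≤ 2 * h + 1`.
  · push Not at hs
    have hx : ∀ w, ∃ x y, x ∈ B w ∧ y ∈ B w ∧ x ≠ y := fun w => by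
      obtain ⟨x⟩ := (hc w).nonempty
      by_contra! hne
      exact hs w x (Set.eq_singleton_iff_unique_mem.2
        ⟨x.2, fun y hy => hne y x hy x.2⟩)
    choose x y hx hy hxy using hx
    have hdis : ∀ {u w a}, a ∈ B u → a ∈ B w → u = w := fun {u w a} hu hw => by
      by_contra hne
      exact Set.disjoint_left.1 (hd u w hne) hu hw
    have hinj : Function.Injective (Sum.elim x y) := by
      refine Function.Injective.sumElim (fun u w h => hdis (hx u) (h ▸ hx w))
        (fun u w h => hdis (hy u) (h ▸ hy w)) (fun u w h => ?_)
      obtain rfl := hdis (hx u) (h ▸ hy w)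
      exact hxy u h
    have := Fintype.card_le_of_injective _ hinj
    simp only [Fintype.card_sum, Fintype.card_fin] at this
    omega

end SimpleGraph
namespace SimpleGraph

variable {V W V' W' : Type*}

/-! ### Self-complementary graphs glued along a bipartite relation -/

/-- The disjoint union of `G` and `K` together with the edges between them given by `R`. -/
def glue (G : SimpleGraph V) (K : SimpleGraph W) (R : V → W → Prop) : SimpleGraph (V ⊕ W) where
  Adj
    | .inl a, .inl b => G.Adj a b
    | .inl a, .inr k => R a k
    | .inr k, .inl a => R a k
    | .inr k, .inr l => K.Adj k l
  symm := ⟨by rintro (a | k) (b | l) h <;> first | exact h | exact h.symm⟩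
  loopless := ⟨by rintro (a | k) h <;> exact SimpleGraph.irrefl _ h⟩

section glue

variable {G : SimpleGraph V} {K : SimpleGraph W} {R : V → W → Prop}

@[simp] theorem glue_adj_inl_inl {a b : V} :
    (glue G K R).Adj (.inl a) (.inl b) ↔ G.Adj a b := Iff.rfl

@[simp] theorem glue_adj_inl_inr {a : V} {k : W} :
    (glue G K R).Adj (.inl a) (.inr k) ↔ R a k := Iff.rfl

@[simp] theorem glue_adj_inr_inl {a : V} {k : W} :
    (glue G K R).Adj (.inr k) (.inl a) ↔ R a k := Iff.rfl

@[simp] theorem glue_adj_inr_inr {k l : W} :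
    (glue G K R).Adj (.inr k) (.inr l) ↔ K.Adj k l := Iff.rfl

/-- `G` is an induced subgraph of `glue G K R`. -/
def glueInl (G : SimpleGraph V) (K : SimpleGraph W) (R : V → W → Prop) : G ↪g glue G K R where
  toFun := Sum.inl
  inj' := Sum.inl_injective
  map_rel_iff' := Iff.rfl

/-- The antimorphisms act side by side, and `hR` says that together they exchange cross edges and
cross non-edges. -/
theorem isSelfComplementary_glue (e : G ≃g Gᶜ) (f : K ≃g Kᶜ)
    (hR : ∀ a k, R (e a) (f k) ↔ ¬R a k) : (glue G K R).IsSelfComplementary := by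
  have he : ∀ a b, Gᶜ.Adj (e a) (e b) ↔ G.Adj a b := fun a b => e.map_adj_iff
  have hf : ∀ a b, Kᶜ.Adj (f a) (f b) ↔ K.Adj a b := fun a b => f.map_adj_iff
  refine ⟨{ toEquiv := Equiv.sumCongr e.toEquiv f.toEquiv, map_rel_iff' := ?_ }⟩
  rintro (a | k) (b | l)
  · simpa [compl_adj] using he a b
  · simpa [compl_adj, not_iff_comm] using not_congr (hR a l)
  · simpa [compl_adj] using not_congr (hR b k)
  · simpa [compl_adj] using hf k l

variable [Fintype V] [Fintype W]

open Classical in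
theorem degree_glue_inl (a : V) :
    (glue G K R).degree (.inl a) = G.degree a + (Finset.univ.filter fun k => R a k).card := by
  rw [← card_neighborFinset_eq_degree, ← card_neighborFinset_eq_degree, ← Finset.card_disjSum]
  congr 1
  ext (b | k) <;> simp

open Classical in
theorem degree_glue_inr (k : W) :
    (glue G K R).degree (.inr k) = (Finset.univ.filter fun a => R a k).card + K.degree k := by
  rw [← card_neighborFinset_eq_degree, ← card_neighborFinset_eq_degree, ← Finset.card_disjSum]
  congr 1
  ext (b | k) <;> simp

end glue

/-! ### Adding a path on four vertices -/

/-- The antimorphism of the path on four vertices. -/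
def pathGraphFourIsoCompl : pathGraph 4 ≃g (pathGraph 4)ᶜ where
  toFun := ![1, 3, 0, 2]
  invFun := ![2, 0, 3, 1]
  left_inv := by decide
  right_inv := by decide
  map_rel_iff' := by
    simp only [compl_adj, pathGraph_adj]
    decide

/-- The graph obtained from `H` by adding a path on four vertices and joining the two inner vertices
of this path to all vertices of `H`. -/
abbrev bull (H : SimpleGraph V) : SimpleGraph (V ⊕ Fin 4) :=
  glue H (pathGraph 4) fun _ k => k = 1 ∨ k = 2

theorem IsSelfComplementary.bull {H : SimpleGraph V} (hH : H.IsSelfComplementary) :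
    H.bull.IsSelfComplementary := by
  obtain ⟨e⟩ := hH
  refine isSelfComplementary_glue e pathGraphFourIsoCompl fun _ => ?_
  change ∀ k : Fin 4, (![1, 3, 0, 2] : Fin 4 → Fin 4) k = 1 ∨ (![1, 3, 0, 2] : Fin 4 → Fin 4) k = 2 ↔
    ¬(k = 1 ∨ k = 2)
  decide

theorem completeGraph_isMinorOf_bull {H : SimpleGraph V} {t : ℕ}
    (h : (completeGraph (Fin t)).IsMinorOf H) :
    (completeGraph (Fin (t + 2))).IsMinorOf H.bull := by
  obtain ⟨B, hc, hd, ha⟩ := h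
  have key : (completeGraph (Fin t ⊕ Fin 2)).IsMinorOf H.bull := by
    refine ⟨Sum.elim (fun w => Sum.inl '' B w) fun i => {Sum.inr ((![1, 2] : Fin 2 → Fin 4) i)},
      ?_, ?_, ?_⟩
    · rintro (w | i)
      · exact (connected_induce_image_iff (glueInl H (pathGraph 4) _) _).2 (hc w)
      · rw [Sum.elim_inr, induce_singleton_eq_top]
        exact connected_top
    · rintro (u | i) (w | j) hne
      · exact (Set.disjoint_image_iff Sum.inl_injective).2 (hd u w (by simpa using hne))
      · simp
      · simp
      · fin_cases i <;> fin_cases j <;> simp_all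
    · rintro (u | i) (w | j) hne
      · obtain ⟨x, hx, y, hy, hxy⟩ := ha u w (by simpa using hne)
        exact ⟨.inl x, ⟨x, hx, rfl⟩, .inl y, ⟨y, hy, rfl⟩, hxy⟩
      · obtain ⟨x⟩ := (hc u).nonempty
        exact ⟨.inl x, ⟨x, x.2, rfl⟩, _, rfl, by fin_cases j <;> simp⟩
      · obtain ⟨x⟩ := (hc w).nonempty
        exact ⟨_, rfl, .inl x, ⟨x, x.2, rfl⟩, by fin_cases i <;> simp⟩
      · refine ⟨_, rfl, _, rfl, ?_⟩
        fin_cases i <;> fin_cases j <;> simp_all [pathGraph_adj]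
  exact isMinorOf_completeGraph_of_injective finSumFinEquiv.symm (Equiv.injective _) key

theorem exists_adj_of_connected_induce {G : SimpleGraph V} {s : Set V} (hs : (G.induce s).Connected)
    {x : V} (hx : x ∈ s) (hne : s ≠ {x}) : ∃ y ∈ s, G.Adj x y := by
  obtain ⟨y, hy, hyx⟩ : ∃ y ∈ s, y ≠ x := by
    by_contra! h
    exact hne (Set.eq_singleton_iff_unique_mem.2 ⟨hx, h⟩)
  have : Nontrivial s := ⟨⟨x, hx⟩, ⟨y, hy⟩, fun h => hyx (congrArg Subtype.val h).symm⟩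
  obtain ⟨z, hz⟩ := hs.preconnected.exists_adj_of_nontrivial ⟨x, hx⟩
  exact ⟨z, z.2, hz⟩

-- The path's ends are leaves. A branch set consisting of one leaf forces `t ≤ 2`; otherwise a
-- branch set containing an end also contains the adjacent inner vertex. Hence all branch sets but
-- the at most two that meet the inner vertices lie in `H`.
open Classical in
theorem le_of_completeGraph_isMinorOf_bull [Fintype V] {H : SimpleGraph V} {t k : ℕ}
    (hk : ∀ s, (completeGraph (Fin s)).IsMinorOf H → s ≤ k)
    (h : (completeGraph (Fin t)).IsMinorOf H.bull) : t ≤ k + 2 := by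
  obtain ⟨B, hc, hd, ha⟩ := h
  have adj_zero : ∀ x, H.bull.Adj (.inr 0) x → x = .inr 1 := by
    rintro (a | l) h
    · simp at h
    · fin_cases l <;> simp_all [pathGraph_adj]
  have adj_three : ∀ x, H.bull.Adj (.inr 3) x → x = .inr 2 := by
    rintro (a | l) h
    · simp at h
    · fin_cases l <;> simp_all [pathGraph_adj]
  have leaf : ∀ x y, (∀ z, H.bull.Adj x z → z = y) → ∀ w, B w = {x} → t ≤ k + 2 :=
    fun x y hxy w hw => by
      have h₁ := card_le_degree_add_one_of_singleton hd (fun u w huw => ha u w huw) hw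
      have h₂ : H.bull.degree x ≤ 1 := by
        rw [← card_neighborFinset_eq_degree, Finset.card_le_one]
        intro a ha b hb
        rw [mem_neighborFinset] at ha hb
        rw [hxy a ha, hxy b hb]
      omega
  by_cases h₀ : ∃ w, B w = {.inr 0}
  · obtain ⟨w, hw⟩ := h₀
    exact leaf _ _ adj_zero w hw
  by_cases h₃ : ∃ w, B w = {.inr 3}
  · obtain ⟨w, hw⟩ := h₃
    exact leaf _ _ adj_three w hw
  push Not at h₀ h₃
  have one_le : ∀ x, (Finset.univ.filter fun w => x ∈ B w).card ≤ 1 := fun x => by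
    refine Finset.card_le_one.2 fun u hu w hw => ?_
    by_contra hne
    exact Set.disjoint_left.1 (hd u w hne) (by simpa using hu) (by simpa using hw)
  let S := Finset.univ.filter fun w => .inr 1 ∉ B w ∧ .inr 2 ∉ B w
  have hS : (completeGraph (Fin S.card)).IsMinorOf H := by
    refine isMinorOf_completeGraph_of_injective (W := S) S.equivFin.symm (Equiv.injective _) ?_
    refine isMinorOf_of_branchSets_subset_range (glueInl H (pathGraph 4) fun _ k => k = 1 ∨ k = 2)
      (fun w => B w) (fun w => hc w) (fun u w huw => hd _ _ (Subtype.coe_ne_coe.2 huw))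
      (fun u w huw => ha _ _ (Subtype.coe_ne_coe.2 huw)) ?_
    rintro ⟨w, hw⟩ (a | l) hl
    · exact ⟨a, rfl⟩
    · obtain ⟨hw₁, hw₂⟩ := (Finset.mem_filter.1 hw).2
      fin_cases l
      · obtain ⟨y, hy, hxy⟩ := exists_adj_of_connected_induce (hc w) hl (h₀ w)
        exact absurd (adj_zero y hxy ▸ hy) hw₁
      · exact absurd hl hw₁
      · exact absurd hl hw₂
      · obtain ⟨y, hy, hxy⟩ := exists_adj_of_connected_induce (hc w) hl (h₃ w)
        exact absurd (adj_three y hxy ▸ hy) hw₂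
  have hcov : (Finset.univ : Finset (Fin t)) ⊆ S ∪ ((Finset.univ.filter fun w => .inr 1 ∈ B w) ∪
      Finset.univ.filter fun w => .inr 2 ∈ B w) := fun w _ => by
    simp only [S, Finset.mem_union, Finset.mem_filter, Finset.mem_univ, true_and]
    tauto
  have h₁ := Finset.card_le_card hcov
  rw [Finset.card_univ, Fintype.card_fin] at h₁
  have h₂ := Finset.card_union_le S ((Finset.univ.filter fun w => .inr 1 ∈ B w) ∪
      Finset.univ.filter fun w => .inr 2 ∈ B w)
  have h₄ := Finset.card_union_le (Finset.univ.filter fun w => .inr 1 ∈ B w)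
      (Finset.univ.filter fun w => .inr 2 ∈ B w)
  have := one_le (.inr 1)
  have := one_le (.inr 2)
  have := hk _ hS
  omega

theorem hadwigerNumber_bull [Finite V] (H : SimpleGraph V) :
    H.bull.hadwigerNumber = H.hadwigerNumber + 2 := by
  have := Fintype.ofFinite V
  obtain ⟨h₁, h₂⟩ := hadwigerNumber_eq_iff.1 (rfl : H.hadwigerNumber = _)
  exact hadwigerNumber_eq_iff.2 ⟨completeGraph_isMinorOf_bull h₁,
    fun t ht => le_of_completeGraph_isMinorOf_bull h₂ ht⟩

/-! ### Blow-ups of the pentagon -/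

/-- The blow-up of the cycle `0, 1, 2, 3, 4` in which `0` is replaced by `H`, the vertices `1` and
`4` by cliques and the vertices `2` and `3` by independent sets. -/
def pentagonBlowup (H : SimpleGraph V) : SimpleGraph (Fin 5 × V) where
  Adj p q := (q.1 = p.1 + 1 ∨ p.1 = q.1 + 1) ∨
    p.1 = q.1 ∧ ((![H, ⊤, ⊥, ⊥, ⊤] : Fin 5 → SimpleGraph V) p.1).Adj p.2 q.2
  symm := ⟨by
    rintro ⟨i, a⟩ ⟨j, b⟩ (h | ⟨h, h'⟩)
    · exact .inl h.symm
    · obtain rfl : i = j := h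
      exact .inr ⟨rfl, h'.symm⟩⟩
  loopless := ⟨by
    rintro ⟨i, a⟩ (h | ⟨-, h⟩)
    · revert h
      simp
    · exact SimpleGraph.irrefl _ h⟩

theorem pentagonBlowup_adj {H : SimpleGraph V} {i j : Fin 5} {a b : V} :
    H.pentagonBlowup.Adj (i, a) (j, b) ↔ (j = i + 1 ∨ i = j + 1) ∨
      i = j ∧ ((![H, ⊤, ⊥, ⊥, ⊤] : Fin 5 → SimpleGraph V) i).Adj a b := Iff.rfl

/-- Multiplication by two as a permutation of the residues modulo five. -/
def doubling : Equiv.Perm (Fin 5) where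
  toFun i := 2 * i
  invFun i := 3 * i
  left_inv := by decide
  right_inv := by decide

/-- The antimorphism of a pentagon blow-up that doubles the index of each part. -/
def pentagonBlowupIsoCompl {H : SimpleGraph V} (e : H ≃g Hᶜ) :
    H.pentagonBlowup ≃g H.pentagonBlowupᶜ where
  -- Doubling sends differences ±1 to ±2 and permutes the parts as `1 → 2 → 4 → 3 → 1`, exchanging
  -- cliques and independent sets. Only the fixed part `0` needs the antimorphism of `H`.
  toEquiv := Equiv.prodShear doubling fun i => if i = 0 then e.toEquiv else Equiv.refl V
  map_rel_iff' := by
    have he : ∀ a b, Hᶜ.Adj (e a) (e b) ↔ H.Adj a b := fun a b => e.map_adj_iff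
    rintro ⟨i, a⟩ ⟨j, b⟩
    fin_cases i <;> fin_cases j <;>
      simp [pentagonBlowup_adj, compl_adj, doubling, Equiv.prodShear]
    rw [← he a b, compl_adj, e.injective.ne_iff]

/-- All neighbours lie in three consecutive parts, which also contain the vertex itself; hence the
strict inequality. -/
theorem degree_pentagonBlowup_lt [Fintype V] {H : SimpleGraph V}
    [DecidableRel H.pentagonBlowup.Adj] (p : Fin 5 × V) :
    H.pentagonBlowup.degree p < 3 * Fintype.card V := by
  classical
  obtain ⟨i, a⟩ := p
  rw [← card_neighborFinset_eq_degree]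
  have : H.pentagonBlowup.neighborFinset (i, a) ⊂ ({i - 1, i, i + 1} : Finset (Fin 5)) ×ˢ .univ := by
    refine Finset.ssubset_iff_subset_ne.2 ⟨fun ⟨j, b⟩ h => ?_, fun h => ?_⟩
    · rw [mem_neighborFinset, pentagonBlowup_adj] at h
      have : j = i + 1 ∨ i = j + 1 ∨ i = j := by tauto
      rcases this with rfl | rfl | rfl <;> simp
    · have : (i, a) ∈ H.pentagonBlowup.neighborFinset (i, a) := by
        rw [h]; simp
      simp at this
  refine (Finset.card_lt_card this).trans_le ?_
  rw [Finset.card_product, Finset.card_univ]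
  exact Nat.mul_le_mul_right _ Finset.card_le_three

/-- A pentagon blow-up with parts of size `t`, extended by a self-complementary graph with a
`K_m` model that is compatible with the parts, has Hadwiger number `3 * t + m`. -/
theorem exists_selfComplementary_of_gadget [Fintype V] [Fintype W] {H : SimpleGraph V}
    (hH : H.IsSelfComplementary) {K : SimpleGraph W} [DecidableRel K.Adj] (f : K ≃g Kᶜ)
    (N : W → Fin 5 → Prop) [∀ k, DecidablePred (N k)] (hN : ∀ i k, N (f k) (2 * i) ↔ ¬N k i) {m : ℕ}
    (x y : Fin m → W)
    (hxy : ∀ w, x w = y w ∨ K.Adj (x w) (y w))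
    (hd : ∀ u w, u ≠ w → x u ≠ x w ∧ x u ≠ y w ∧ y u ≠ y w)
    (ha : ∀ u w, u ≠ w →
      K.Adj (x u) (x w) ∨ K.Adj (x u) (y w) ∨ K.Adj (y u) (x w) ∨ K.Adj (y u) (y w))
    (hx₁ : ∀ w, N (x w) 1 ∨ N (y w) 1)
    (hx₂ : ∀ w, N (x w) 2 ∨ N (y w) 2 ∨ N (x w) 3 ∨ N (y w) 3)
    (hx₄ : ∀ w, N (x w) 4 ∨ N (y w) 4 ∨ N (x w) 0 ∨ N (y w) 0)
    (hK : ∀ k, K.degree k < m) (hcard : Fintype.card W ≤ 2 * m + 1)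
    (hNi : ∀ i, (Finset.univ.filter fun k => N k i).card ≤ m)
    (hNk : ∀ k, (Finset.univ.filter (N k)).card ≤ 3) :
    ∃ G : SimpleGraph (Fin 5 × V ⊕ W),
      G.IsSelfComplementary ∧ G.hadwigerNumber = 3 * Fintype.card V + m := by
  classical
  obtain ⟨e⟩ := hH
  refine ⟨glue H.pentagonBlowup K fun p k => N k p.1,
    isSelfComplementary_glue (pentagonBlowupIsoCompl e) f fun p => hN p.1,
    hadwigerNumber_eq_iff.2 ⟨?_, fun t => le_of_completeGraph_isMinorOf_of_degree_lt ?_ ?_⟩⟩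
  · have key : (completeGraph ((Fin 3 × V) ⊕ Fin m)).IsMinorOf
        (glue H.pentagonBlowup K fun p k => N k p.1) := by
      -- The blow-up contributes the vertices of part `1` and matchings between parts `2`, `3` and
      -- between parts `4`, `0`. The hypotheses `hx₁`, `hx₂`, `hx₄` make each gadget branch set
      -- adjacent to all three kinds.
      refine isMinorOf_completeGraph_of_pairs
        (Sum.map (fun p => ((![1, 2, 4] : Fin 3 → Fin 5) p.1, p.2)) x)
        (Sum.map (fun p => ((![1, 3, 0] : Fin 3 → Fin 5) p.1, p.2)) y) ?_ ?_ ?_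
      · rintro (⟨i, a⟩ | w)
        · fin_cases i <;> simp [pentagonBlowup_adj]
        · simpa using hxy w
      · rintro (⟨i, a⟩ | w) (⟨j, b⟩ | z) hne
        · fin_cases i <;> fin_cases j <;> simp_all
        · simp
        · simp
        · simpa using hd w z (by simpa using hne)
      · rintro (⟨i, a⟩ | w) (⟨j, b⟩ | z) hne
        · fin_cases i <;> fin_cases j <;> simp_all [pentagonBlowup_adj]
        · have := hx₁ z
          have := hx₂ z
          have := hx₄ z
          fin_cases i <;> simp <;> tauto
        · have := hx₁ w
          have := hx₂ w
          have := hx₄ w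
          fin_cases j <;> simp <;> tauto
        · simpa using ha w z (by simpa using hne)
    refine isMinorOf_completeGraph_of_injective
      (Fintype.equivFinOfCardEq (n := 3 * Fintype.card V + m) ?_).symm (Equiv.injective _) key
    simp
  · rintro (p | k)
    · rw [degree_glue_inl]
      have := degree_pentagonBlowup_lt (H := H) p
      have := hNi p.1
      convert Nat.add_lt_add_of_lt_of_le ‹_ < 3 * Fintype.card V› this
    · rw [degree_glue_inr]
      have h₁ : (Finset.univ.filter fun p : Fin 5 × V => N k p.1).card ≤ 3 * Fintype.card V := by
        rw [← Finset.univ_product_univ, Finset.filter_product_left, Finset.card_product,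
          Finset.card_univ]
        exact Nat.mul_le_mul_right _ (hNk k)
      have h₂ := hK k
      convert Nat.add_lt_add_of_le_of_lt h₁ h₂
  · simp only [Fintype.card_sum, Fintype.card_prod, Fintype.card_fin]
    omega

end SimpleGraph
namespace SimpleGraph

/-! ### A gadget on twelve vertices -/

/-- A self-complementary graph on twelve vertices with a `K₇` minor and maximum degree six. -/
def twelveGadget : SimpleGraph (Fin 12) where
  Adj k l := Nat.testBit (![860, 2388, 3155, 1617, 143, 4032, 47, 3888, 2211, 3241, 684, 934] k) l
  symm := ⟨by decide⟩
  loopless := ⟨by decide⟩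

instance : DecidableRel twelveGadget.Adj := fun _ _ => inferInstanceAs (Decidable (_ = true))

/-- The parts of a pentagon blow-up to which a vertex of `twelveGadget` is attached. -/
def twelveGadgetLink (k : Fin 12) (i : Fin 5) : Prop :=
  Nat.testBit (![28, 5, 14, 9, 3, 26, 17, 22, 3, 26, 17, 22] k) i

instance (k : Fin 12) : DecidablePred (twelveGadgetLink k) :=
  fun _ => inferInstanceAs (Decidable (_ = true))

/-- The antimorphism of `twelveGadget`, with three orbits of length four. -/
def twelveGadgetIsoCompl : twelveGadget ≃g twelveGadgetᶜ where
  toFun := ![1, 2, 3, 0, 5, 6, 7, 4, 9, 10, 11, 8]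
  invFun := ![3, 0, 1, 2, 7, 4, 5, 6, 11, 8, 9, 10]
  left_inv := by decide
  right_inv := by decide
  map_rel_iff' := by
    simp only [compl_adj]
    decide

theorem exists_selfComplementary_twelveGadget {V : Type*} [Fintype V] {H : SimpleGraph V}
    (hH : H.IsSelfComplementary) : ∃ G : SimpleGraph (Fin 5 × V ⊕ Fin 12),
      G.IsSelfComplementary ∧ G.hadwigerNumber = 3 * Fintype.card V + 7 := by
  refine exists_selfComplementary_of_gadget hH twelveGadgetIsoCompl twelveGadgetLink ?_
    -- Five edges and the singletons `7` and `11` form the `K₇` model.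
    ![0, 1, 2, 3, 5, 7, 11] ![8, 4, 10, 9, 6, 7, 11] ?_ ?_ ?_ ?_ ?_ ?_ ?_ ?_ ?_ ?_
  · change ∀ i k, twelveGadgetLink ((![1, 2, 3, 0, 5, 6, 7, 4, 9, 10, 11, 8] : Fin 12 → Fin 12) k)
      (2 * i) ↔ ¬twelveGadgetLink k i
    decide
  all_goals decide

theorem exists_selfComplementary_pentagonBlowup {V : Type*} [Fintype V] {H : SimpleGraph V}
    (hH : H.IsSelfComplementary) : ∃ G : SimpleGraph (Fin 5 × V ⊕ Fin 0),
      G.IsSelfComplementary ∧ G.hadwigerNumber = 3 * Fintype.card V := by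
  refine exists_selfComplementary_of_gadget (m := 0) (K := (⊥ : SimpleGraph (Fin 0))) hH
    ⟨Equiv.refl _, fun {a} => a.elim0⟩ (fun _ _ => False) (fun _ k => k.elim0) Fin.elim0 Fin.elim0
    (fun w => w.elim0) (fun w => w.elim0) (fun w => w.elim0) (fun w => w.elim0) (fun w => w.elim0)
    (fun w => w.elim0) (fun k => k.elim0) ?_ ?_ (fun k => k.elim0)
  · simp
  · simp

/-! ### Existence -/

theorem IsSelfComplementary.of_iso {V W : Type*} {G : SimpleGraph V} {G' : SimpleGraph W}
    (e : G ≃g G') (h : G.IsSelfComplementary) : G'.IsSelfComplementary := by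
  obtain ⟨f⟩ := h
  refine ⟨(e.symm.trans f).trans ⟨e.toEquiv, fun {a b} => ?_⟩⟩
  have : G'.Adj (e a) (e b) ↔ G.Adj a b := e.map_adj_iff
  simpa [compl_adj] using fun _ => not_congr this

theorem exists_fin_of_card {V : Type*} [Fintype V] {n h : ℕ} (hn : Fintype.card V = n)
    (hG : ∃ G : SimpleGraph V, G.IsSelfComplementary ∧ G.hadwigerNumber = h) :
    ∃ G : SimpleGraph (Fin n), G.IsSelfComplementary ∧ G.hadwigerNumber = h := by
  obtain ⟨G, hG, hh⟩ := hG
  let e := Iso.map (Fintype.equivFinOfCardEq hn) G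
  exact ⟨_, hG.of_iso e, e.hadwigerNumber_eq.symm.trans hh⟩

theorem exists_isSelfComplementary {n : ℕ} (hn : n % 4 = 0 ∨ n % 4 = 1) :
    ∃ G : SimpleGraph (Fin n), G.IsSelfComplementary := by
  induction n using Nat.strong_induction_on with
  | _ n ih =>
    by_cases h4 : 4 ≤ n
    · obtain ⟨H, hH⟩ := ih (n - 4) (by omega) (by omega)
      obtain ⟨G, hG, -⟩ := exists_fin_of_card (n := n) (by simp; omega) ⟨H.bull, hH.bull, rfl⟩
      exact ⟨G, hG⟩
    -- The congruence leaves only `n = 0` and `n = 1`.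
    · have : Subsingleton (Fin n) := Fin.subsingleton_iff_le_one.2 (by omega)
      exact ⟨⊥, ⟨⟨Equiv.refl _, fun {a b} => by simp [Subsingleton.elim a b]⟩⟩⟩

end SimpleGraph

open SimpleGraph in
theorem theorem1 (n : ℕ) (hn : n ≡ 0 [MOD 4] ∨ n ≡ 1 [MOD 4])
    (h : ℕ) (hlow : (n + 1) / 2 ≤ h) (hup : h ≤ 3 * n / 5) :
    ∃ G : SimpleGraph (Fin n), G.IsSelfComplementary ∧ G.hadwigerNumber = h := by
  induction n using Nat.strong_induction_on generalizing h with
  | _ n ih =>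
    simp only [Nat.ModEq] at hn ih
    -- The lower bound on `h` drops by exactly 2 with `n - 4`, so only the upper bound needs
    -- checking.
    by_cases hstep : 4 ≤ n ∧ h - 2 ≤ 3 * (n - 4) / 5
    · obtain ⟨H, hH, hHh⟩ := ih (n - 4) (by omega) (by omega) (h - 2) (by omega) (by omega)
      refine exists_fin_of_card (by simp; omega) ⟨H.bull, hH.bull, ?_⟩
      rw [hadwigerNumber_bull, hHh]
      omega
    · by_cases h5 : n % 5 = 0
      · obtain ⟨H, hH⟩ := exists_isSelfComplementary (n := n / 5) (by omega)
        obtain ⟨G, hG, hGh⟩ := exists_selfComplementary_pentagonBlowup hH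
        refine exists_fin_of_card (by simp; omega) ⟨G, hG, hGh.trans ?_⟩
        simp
        omega
      -- The range of `h` is empty for `n = 1`. Otherwise `n ≡ 2 (mod 5)`, and the condition modulo
      -- 4 gives `n ≡ 12` or `17 (mod 20)`, so `t` is again `0` or `1` modulo 4.
      · obtain ⟨t, rfl⟩ : ∃ t, n = 5 * t + 12 := by
          have h2 : n % 5 = 2 := by
            have : n % 5 = 1 ∨ n % 5 = 2 ∨ n % 5 = 3 ∨ n % 5 = 4 := by omega
            rcases this with h | h | h | h <;> omega
          exact ⟨(n - 12) / 5, by omega⟩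
        obtain ⟨H, hH⟩ := exists_isSelfComplementary (n := t) (by omega)
        obtain ⟨G, hG, hGh⟩ := exists_selfComplementary_twelveGadget hH
        refine exists_fin_of_card (by simp [mul_comm]) ⟨G, hG, hGh.trans ?_⟩
        rw [Fintype.card_fin]
        omega
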